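/- There are universal constants $C_1, C_2 > 0$ such that the following holds. Let $d \ge 0$ and $n \ge 1$ be integers, $\delta \in (0,1)$, $w_\star \in \mathbb{R}^d$, and let $B, R, \lambda, \gamma$ be real numbers with $\lambda, \gamma > 0$, $BR \ge 1$ and $\|w_\star\|_2 \le R$. Let $D_x$ be a probability distribution on $\mathbb{R}^d$ that is supported in $\{x : \|x\|_2 \le B\}$ and satisfies $\mathbb{E}_{x \sim D_x}[x x^\top] \succeq \lambda I$. Let $\sigma : \mathbb{R} \to \mathbb{R}$ be strictly increasing and twice differentiable, with $\sigma(t) \in [0,1]$, $|\sigma'(t)| \le 1$ and $|\sigma''(t)| \le 1$ for all $t \in \mathbb{R}$, and $\sigma'(t) \ge \gamma$ for all $t \in [-BR, BR]$. Let $(x_1,\epsilon_1),\dots,(x_n,\epsilon_n)$ be i.i.d. pairs, where $x_i$ has distribution $D_x$, and $\epsilon_i$ is a real random variable independent of $x_i$ with $\mathbb{E}[\epsilon_i] = 0$ and $|\epsilon_i| \le 1$ almost surely. Put $y_i = \sigma(w_\star^\top x_i) + \epsilon_i$ and $$\widehat{L}(w) = \frac{1}{2n} \sum_{i=1}^n \bigl(y_i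 - \sigma(w^\top x_i)\bigr)^2 , \qquad w \in \mathbb{R}^d .$$ Then, with probability at least $1-\delta$, every $w \in \mathbb{R}^d$ with $\|w\|_2 \le R$ such that $\nabla \widehat{L}(w) = 0$ (in particular, every local minimum $w$ of $\widehat{L}$ with $\|w\|_2 \le R$) satisfies $$\|w - w_\star\|_2 \le \frac{C_1 B}{\gamma^2 \lambda} \sqrt{\frac{d\,(C_2 + \log(nBR)) + \log\frac{1}{\delta}}{n}} .$$ -/

import Mathlib

open MeasureTheory ProbabilityTheory

namespace GLM

/-- The labels `y i = σ(w⋆ᵀ x i) + ε i` of a generalized linear model. -/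
noncomputable def labels {d n : ℕ} (σ : ℝ → ℝ) (wstar : EuclideanSpace ℝ (Fin d))
    (x : Fin n → EuclideanSpace ℝ (Fin d)) (ε : Fin n → ℝ) : Fin n → ℝ :=
  fun i => σ (inner ℝ wstar (x i)) + ε i

/-- The empirical squared risk `(1 / (2n)) ∑ i, (y i - σ(wᵀ x i))²`. -/
noncomputable def empiricalRisk {d n : ℕ} (σ : ℝ → ℝ)
    (x : Fin n → EuclideanSpace ℝ (Fin d)) (y : Fin n → ℝ)
    (w : EuclideanSpace ℝ (Fin d)) : ℝ :=
  (1 / (2 * (n : ℝ))) * ∑ i, (y i - σ (inner ℝ w (x i))) ^ 2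

/-- The second moment matrix `E[x xᵀ]` of a distribution on `ℝ^d`. -/
noncomputable def secondMoment {d : ℕ} (D : Measure (EuclideanSpace ℝ (Fin d))) :
    Matrix (Fin d) (Fin d) ℝ :=
  Matrix.of fun i j => ∫ x, x i * x j ∂D

end GLM

/-! The risk is not convex, but its gradient at `w` tested in the direction `w - wstar` is positive
on average. The noise is centered and independent of `x`, so it drops out of the mean, and with `s =
wᵀx`, `t = wstarᵀx` in `[-BR, BR]` one has `(σ s - σ t) σ'(s) (s - t) ≥ γ² (s - t)²`. The second
moment bound then gives mean at least `γ² λ ‖w - wstar‖²` (`le_integral_score`).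

For fixed `w` this is a sum of independent scalars of size at most `2B‖w - wstar‖`, so Hoeffding
suffices, and its error is also linear in `‖w - wstar‖`. A union bound covers a net of radius
`1/(nB)` (`exists_finset_net_closedBall`). A critical point `w` has zero score in every direction,
in particular along `w' - wstar` for a nearby net point `w'`; the Lipschitz bound `abs_score_sub_le`
makes the score at `w'` small, and dividing by `‖w' - wstar‖` bounds that distance
(`norm_sub_le_of_sum_score`). -/

/-! ### Nets of balls and concentration of bounded sums -/

/-- Volumetric bound on the cardinality of an `r`-separated subset of a ball of radius `R`. -/
theorem card_le_of_separated_of_norm_le {E : Type*} [NormedAddCommGroup E] [NormedSpace ℝ E]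
    [FiniteDimensional ℝ E] {r R : ℝ} (hr : 0 < r) (hrR : r ≤ R) (s : Finset E)
    (hs : ∀ c ∈ s, ‖c‖ ≤ R) (h : ∀ c ∈ s, ∀ c' ∈ s, c ≠ c' → r ≤ ‖c - c'‖) :
    (s.card : ℝ) ≤ (3 * R / r) ^ Module.finrank ℝ E := by
  borelize E
  let μ : Measure E := Measure.addHaar
  have hr2 : 0 < r / 2 := by positivity
  have hρ : 0 < 3 * R / 2 := by linarith
  have D : (s : Set E).PairwiseDisjoint (fun c => Metric.ball c (r / 2)) := by
    intro c hc c' hc' hcc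
    apply Metric.ball_disjoint_ball
    rw [dist_eq_norm]
    linarith [h c hc c' hc' hcc]
  have hsub : (⋃ c ∈ s, Metric.ball c (r / 2)) ⊆ Metric.ball (0 : E) (3 * R / 2) := by
    refine Set.iUnion₂_subset fun c hc => Metric.ball_subset_ball' ?_
    rw [dist_zero_right]
    linarith [hs c hc]
  have I : (s.card : ENNReal) * ENNReal.ofReal ((r / 2) ^ Module.finrank ℝ E)
      * μ (Metric.ball 0 1) ≤
      ENNReal.ofReal ((3 * R / 2) ^ Module.finrank ℝ E) * μ (Metric.ball 0 1) := by
    calc _ = μ (⋃ c ∈ s, Metric.ball c (r / 2)) := by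
          rw [measure_biUnion_finset D fun c _ => measurableSet_ball]
          simp only [μ.addHaar_ball_of_pos _ hr2, Finset.sum_const, nsmul_eq_mul, mul_assoc]
      _ ≤ μ (Metric.ball (0 : E) (3 * R / 2)) := measure_mono hsub
      _ = _ := by simp only [μ.addHaar_ball_of_pos _ hρ]
  have J : (s.card : ENNReal) * ENNReal.ofReal ((r / 2) ^ Module.finrank ℝ E) ≤
      ENNReal.ofReal ((3 * R / 2) ^ Module.finrank ℝ E) :=
    (ENNReal.mul_le_mul_iff_left (Metric.measure_ball_pos _ _ zero_lt_one).ne'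
      measure_ball_lt_top.ne).1 I
  have K := ENNReal.toReal_le_of_le_ofReal (by positivity) J
  rw [ENNReal.toReal_mul, ENNReal.toReal_natCast, ENNReal.toReal_ofReal (by positivity)] at K
  have : 3 * R / r = (3 * R / 2) / (r / 2) := by field_simp
  rw [this, div_pow, le_div_iff₀ (by positivity)]
  exact K

/-- A ball of radius `R` has an `r`-net of cardinality at most `(3 R / r) ^ d`. -/
theorem exists_finset_net_closedBall (E : Type*) [NormedAddCommGroup E] [NormedSpace ℝ E]
    [FiniteDimensional ℝ E] {r R : ℝ} (hr : 0 < r) (hrR : r ≤ R) :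
    ∃ s : Finset E, (∀ c ∈ s, ‖c‖ ≤ R) ∧ (∀ w : E, ‖w‖ ≤ R → ∃ c ∈ s, ‖w - c‖ ≤ r) ∧
      (s.card : ℝ) ≤ (3 * R / r) ^ Module.finrank ℝ E := by
  classical
  let A : Set ℕ := {N | ∃ s : Finset E, s.card = N ∧ (∀ c ∈ s, ‖c‖ ≤ R) ∧
    ∀ c ∈ s, ∀ c' ∈ s, c ≠ c' → r ≤ ‖c - c'‖}
  have hA : BddAbove A := by
    refine ⟨⌊(3 * R / r) ^ Module.finrank ℝ E⌋₊, ?_⟩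
    rintro _ ⟨s, rfl, h1, h2⟩
    exact Nat.le_floor (card_le_of_separated_of_norm_le hr hrR s h1 h2)
  -- A separated set of maximal cardinality is a net: a point farther than `r` from all of it could
  -- be added.
  obtain ⟨s, hcard, hs, hsep⟩ : sSup A ∈ A := Nat.sSup_mem ⟨0, ∅, by simp⟩ hA
  refine ⟨s, hs, fun w hw => ?_, card_le_of_separated_of_norm_le hr hrR s hs hsep⟩
  by_contra! hfar
  have hws : w ∉ s := fun h => by simpa using (hfar w h).trans_le' hr.le
  have : (insert w s).card ≤ sSup A := by
    refine le_csSup hA ⟨_, rfl, ?_, ?_⟩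
    · simpa [hw] using hs
    · intro c hc c' hc' hne
      rcases Finset.mem_insert.1 hc with rfl | h1 <;> rcases Finset.mem_insert.1 hc' with rfl | h2
      · exact absurd rfl hne
      · exact (hfar _ h2).le
      · rw [norm_sub_rev]; exact (hfar _ h1).le
      · exact hsep _ h1 _ h2 hne
  rw [Finset.card_insert_of_notMem hws] at this
  omega

/-- One-sided Hoeffding inequality for independent variables bounded by `b` with means at
least `m`. -/
theorem hoeffding_lower_tail {Ω : Type*} [MeasurableSpace Ω] {P : Measure Ω}
    [IsProbabilityMeasure P] {n : ℕ} (hn : 1 ≤ n) {Z : Fin n → Ω → ℝ} (hZ : iIndepFun Z P)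
    (hZm : ∀ i, Measurable (Z i)) {b m L : ℝ} (hb : 0 < b) (hL : 0 ≤ L)
    (hZb : ∀ i, ∀ᵐ ω ∂P, |Z i ω| ≤ b) (hm : ∀ i, m ≤ ∫ ω, Z i ω ∂P) :
    P.real {ω | ∑ i, Z i ω < n * m - b * √(2 * n * L)} ≤ Real.exp (-L) := by
  have hn0 : (0 : ℝ) < n := by exact_mod_cast hn
  let W : Fin n → Ω → ℝ := fun i ω => -Z i ω - ∫ ω, -Z i ω ∂P
  have hW : iIndepFun W P :=
    hZ.comp (fun i z => -z - ∫ ω, -Z i ω ∂P) (fun i => measurable_neg.sub_const _)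
  have hsub : ∀ i ∈ Finset.univ, HasSubgaussianMGF (W i) ((‖b - (-b)‖₊ / 2) ^ 2) P := by
    intro i _
    refine hasSubgaussianMGF_of_mem_Icc (X := fun ω => -Z i ω) (hZm i).neg.aemeasurable ?_
    filter_upwards [hZb i] with ω h
    rw [abs_le] at h
    constructor <;> linarith
  have key := HasSubgaussianMGF.measure_sum_ge_le_of_iIndepFun hW hsub
    (ε := b * √(2 * n * L)) (by positivity)
  -- Each summand has variance proxy `b ^ 2`, so the deviation `b * √(2 * n * L)` makes the exponent
  -- exactly `-L`.
  have hc : (-(b * √(2 * n * L)) ^ 2 /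
      (2 * ((∑ _i : Fin n, (‖b - (-b)‖₊ / 2) ^ 2 : NNReal) : ℝ))) = -L := by
    have h2 : ‖b - -b‖ = 2 * b := by
      rw [Real.norm_eq_abs, sub_neg_eq_add, abs_of_pos (by positivity)]; ring
    push_cast
    rw [h2, mul_pow, Real.sq_sqrt (by positivity)]
    simp
    field_simp
  rw [hc] at key
  refine (measureReal_mono ?_).trans key
  intro ω hω
  simp only [Set.mem_ofPred_eq] at hω ⊢
  have : ∑ i, W i ω = ∑ i, ∫ ω, Z i ω ∂P - ∑ i, Z i ω := by
    rw [← Finset.sum_sub_distrib]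
    refine Finset.sum_congr rfl fun i _ => ?_
    simp only [W, integral_neg]
    ring
  rw [this]
  have h3 : n * m ≤ ∑ i, ∫ ω, Z i ω ∂P := by
    have := Finset.card_nsmul_le_sum Finset.univ (fun i => ∫ ω, Z i ω ∂P) m fun i _ => hm i
    simpa using this
  linarith

/-! ### The score: criticality, Lipschitz and size bounds, expectation -/

namespace GLM

/-- The derivative in direction `u` at `w` of `w ↦ (y - σ(wᵀ x))² / 2`. -/
noncomputable def score {d : ℕ} (σ : ℝ → ℝ) (y : ℝ) (w x u : EuclideanSpace ℝ (Fin d)) : ℝ :=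
  (σ (inner ℝ w x) - y) * deriv σ (inner ℝ w x) * inner ℝ u x

theorem hasFDerivAt_empiricalRisk {d n : ℕ} {σ : ℝ → ℝ} (hσ : Differentiable ℝ σ)
    (x : Fin n → EuclideanSpace ℝ (Fin d)) (y : Fin n → ℝ) (w : EuclideanSpace ℝ (Fin d)) :
    HasFDerivAt (empiricalRisk σ x y)
      ((1 / (n : ℝ)) • ∑ i, ((σ (inner ℝ w (x i)) - y i) * deriv σ (inner ℝ w (x i))) •
        innerSL ℝ (x i)) w := by
  have h1 : ∀ i, HasFDerivAt (fun w : EuclideanSpace ℝ (Fin d) => inner ℝ w (x i))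
      (innerSL ℝ (x i)) w := fun i => by
    simpa [real_inner_comm] using (innerSL ℝ (x i)).hasFDerivAt (x := w)
  have h2 := fun i => (((hσ (inner ℝ w (x i))).hasDerivAt.comp_hasFDerivAt w (h1 i)).const_sub
    (y i)).pow 2
  have h3 := (HasFDerivAt.fun_sum (u := Finset.univ) fun i _ => h2 i).const_mul (1 / (2 * (n : ℝ)))
  refine h3.congr_fderiv ?_
  rw [Finset.smul_sum, Finset.smul_sum]
  refine Finset.sum_congr rfl fun i _ => ?_
  ext u
  simp
  ring

/-- Every direction `u` is needed: it will be `w' - wstar` with `w'` a net point, not `w - wstar`.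
-/
theorem sum_score_eq_zero {d n : ℕ} (hn : 1 ≤ n) {σ : ℝ → ℝ} (hσ : Differentiable ℝ σ)
    {x : Fin n → EuclideanSpace ℝ (Fin d)} {y : Fin n → ℝ} {w : EuclideanSpace ℝ (Fin d)}
    (hw : gradient (empiricalRisk σ x y) w = 0 ∨ IsLocalMin (empiricalRisk σ x y) w)
    (u : EuclideanSpace ℝ (Fin d)) : ∑ i, score σ (y i) w (x i) u = 0 := by
  have h0 : fderiv ℝ (empiricalRisk σ x y) w = 0 := by
    rcases hw with h | h
    · simpa [gradient] using h
    · exact h.fderiv_eq_zero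
  rw [(hasFDerivAt_empiricalRisk hσ x y w).fderiv] at h0
  have hn0 : (n : ℝ) ≠ 0 := by positivity
  have h1 := congrArg (fun f => f u) h0
  simp [hn0] at h1
  rw [← h1]
  refine Finset.sum_congr rfl fun i _ => ?_
  simp only [score]
  rw [real_inner_comm u]

theorem lipschitz_of_abs_deriv_le {f : ℝ → ℝ} (hf : Differentiable ℝ f)
    (hf' : ∀ t, |deriv f t| ≤ 1) (s t : ℝ) : |f s - f t| ≤ |s - t| := by
  simpa using Convex.norm_image_sub_le_of_norm_deriv_le (𝕜 := ℝ) (fun x _ => hf x)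
    (fun x _ => hf' x) convex_univ (Set.mem_univ t) (Set.mem_univ s)

/-- Product rule in Lipschitz form: varying the residual costs `1`, and varying `deriv σ` against a
residual of size at most `2` costs `2`, hence the factor `3`. -/
theorem abs_score_sub_le {d : ℕ} {σ : ℝ → ℝ} (hσ : Differentiable ℝ σ)
    (hσ' : Differentiable ℝ (deriv σ)) (hd : ∀ t, |deriv σ t| ≤ 1)
    (hdd : ∀ t, |deriv (deriv σ) t| ≤ 1) {y : ℝ} (hy : ∀ t, |σ t - y| ≤ 2) {B : ℝ}
    {x : EuclideanSpace ℝ (Fin d)} (hx : ‖x‖ ≤ B) (w w' u : EuclideanSpace ℝ (Fin d)) :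
    |score σ y w x u - score σ y w' x u| ≤ 3 * B ^ 2 * ‖w - w'‖ * ‖u‖ := by
  have hB : 0 ≤ B := (norm_nonneg x).trans hx
  set s := inner ℝ w x
  set t := inner ℝ w' x
  have hst : |s - t| ≤ ‖w - w'‖ * B := by
    simp only [s, t, ← inner_sub_left]
    exact (abs_real_inner_le_norm _ _).trans (by gcongr)
  have hu : |inner ℝ u x| ≤ ‖u‖ * B := (abs_real_inner_le_norm _ _).trans (by gcongr)
  have e : score σ y w x u - score σ y w' x u =
      ((σ s - σ t) * deriv σ s + (σ t - y) * (deriv σ s - deriv σ t)) * inner ℝ u x := by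
    simp only [score, s, t]; ring
  have h1 : |(σ s - σ t) * deriv σ s + (σ t - y) * (deriv σ s - deriv σ t)| ≤
      (‖w - w'‖ * B) * 1 + 2 * (‖w - w'‖ * B) := by
    refine (abs_add_le _ _).trans ?_
    rw [abs_mul, abs_mul]
    gcongr
    · exact (lipschitz_of_abs_deriv_le hσ hd s t).trans hst
    · exact hd s
    · exact hy t
    · exact (lipschitz_of_abs_deriv_le hσ' hdd s t).trans hst
  rw [e, abs_mul]
  calc _ ≤ ((‖w - w'‖ * B) * 1 + 2 * (‖w - w'‖ * B)) * (‖u‖ * B) := by gcongr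
    _ = _ := by ring

theorem abs_score_le {d : ℕ} {σ : ℝ → ℝ} (hd : ∀ t, |deriv σ t| ≤ 1) {y : ℝ}
    (hy : ∀ t, |σ t - y| ≤ 2) {B : ℝ} {x : EuclideanSpace ℝ (Fin d)} (hx : ‖x‖ ≤ B)
    (w u : EuclideanSpace ℝ (Fin d)) : |score σ y w x u| ≤ 2 * B * ‖u‖ := by
  have hB : 0 ≤ B := (norm_nonneg x).trans hx
  have hu : |inner ℝ u x| ≤ ‖u‖ * B := (abs_real_inner_le_norm _ _).trans (by gcongr)
  rw [score, abs_mul, abs_mul]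
  calc _ ≤ 2 * 1 * (‖u‖ * B) := by
        gcongr
        · exact hy _
        · exact hd _
    _ = _ := by ring

theorem abs_sub_label_le {σ : ℝ → ℝ} (hσ01 : ∀ t, σ t ∈ Set.Icc (0 : ℝ) 1) {e : ℝ}
    (he : |e| ≤ 1) (t s : ℝ) : |σ t - (σ s + e)| ≤ 2 := by
  rw [abs_le] at he ⊢
  constructor <;> linarith [(hσ01 t).1, (hσ01 t).2, (hσ01 s).1, (hσ01 s).2]

theorem measurable_score {d : ℕ} {σ : ℝ → ℝ} (hσ : Continuous σ) (hσ' : Continuous (deriv σ))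
    (wstar w u : EuclideanSpace ℝ (Fin d)) :
    Measurable fun p : EuclideanSpace ℝ (Fin d) × ℝ =>
      score σ (σ (inner ℝ wstar p.1) + p.2) w p.1 u := by
  unfold score
  exact Continuous.measurable (by fun_prop)

/-- In the noiseless case the score in direction `w - w⋆` dominates `γ² ⟨w - w⋆, x⟩²`. -/
theorem sq_mul_inner_sq_le_score {d : ℕ} {σ : ℝ → ℝ}
    (hσ : Differentiable ℝ σ) {γ M : ℝ} (hγ : 0 < γ)
    (hγσ : ∀ t ∈ Set.Icc (-M) M, γ ≤ deriv σ t) {w wstar x : EuclideanSpace ℝ (Fin d)}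
    (hw : |inner ℝ w x| ≤ M) (hws : |inner ℝ wstar x| ≤ M) :
    γ ^ 2 * inner ℝ (w - wstar) x ^ 2 ≤ score σ (σ (inner ℝ wstar x)) w x (w - wstar) := by
  rw [score, inner_sub_left]
  set s := inner ℝ w x
  set t := inner ℝ wstar x
  have hs : s ∈ Set.Icc (-M) M := abs_le.1 hw
  have ht : t ∈ Set.Icc (-M) M := abs_le.1 hws
  have mv : ∀ a ∈ Set.Icc (-M) M, ∀ b ∈ Set.Icc (-M) M, a ≤ b → γ * (b - a) ≤ σ b - σ a :=
    (convex_Icc _ _).mul_sub_le_image_sub_of_le_deriv hσ.continuous.continuousOn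
      hσ.differentiableOn fun a ha => hγσ a (interior_subset ha)
  have h1 : γ * (s - t) ^ 2 ≤ (σ s - σ t) * (s - t) := by
    rcases le_total t s with h | h
    · nlinarith [mv t ht s hs h]
    · nlinarith [mv s hs t ht h]
  have h2 := hγσ s hs
  calc γ ^ 2 * (s - t) ^ 2 = γ * (γ * (s - t) ^ 2) := by ring
    _ ≤ deriv σ s * ((σ s - σ t) * (s - t)) :=
        mul_le_mul h2 h1 (by positivity) (hγ.le.trans h2)
    _ = _ := by ring

/-- The integral is the quadratic form of the second moment matrix at `v`; boundedness of `x` makes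
its entries integrable. -/
theorem le_integral_inner_sq {d : ℕ} {D : Measure (EuclideanSpace ℝ (Fin d))}
    [IsProbabilityMeasure D] {B lam : ℝ} (hB : ∀ᵐ x ∂D, ‖x‖ ≤ B)
    (h : (secondMoment D - lam • (1 : Matrix (Fin d) (Fin d) ℝ)).PosSemidef)
    (v : EuclideanSpace ℝ (Fin d)) : lam * ‖v‖ ^ 2 ≤ ∫ x, inner ℝ v x ^ 2 ∂D := by
  have hint : ∀ i j, Integrable (fun x : EuclideanSpace ℝ (Fin d) => x i * x j) D := by
    intro i j
    refine Integrable.of_bound (by fun_prop) (B * B) ?_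
    filter_upwards [hB] with x hx
    rw [norm_mul]
    have h1 := (PiLp.norm_apply_le x i).trans hx
    have h2 := (PiLp.norm_apply_le x j).trans hx
    gcongr
    exact (norm_nonneg _).trans h1
  have h1 := h.dotProduct_mulVec_nonneg v
  have h2 : ∫ x, inner ℝ v x ^ 2 ∂D = ∑ i, ∑ j, v i * (v j * ∫ x, x i * x j ∂D) := by
    have : ∀ x : EuclideanSpace ℝ (Fin d),
        inner ℝ v x ^ 2 = ∑ i, ∑ j, v i * (v j * (x i * x j)) := by
      intro x
      rw [PiLp.inner_apply, sq, Finset.sum_mul_sum]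
      refine Finset.sum_congr rfl fun i _ => Finset.sum_congr rfl fun j _ => ?_
      simp
      ring
    simp_rw [this]
    rw [integral_finsetSum _ fun i _ => integrable_finsetSum _ fun j _ =>
      ((hint i j).const_mul _).const_mul _]
    refine Finset.sum_congr rfl fun i _ => ?_
    rw [integral_finsetSum _ fun j _ => ((hint i j).const_mul _).const_mul _]
    refine Finset.sum_congr rfl fun j _ => ?_
    rw [integral_const_mul, integral_const_mul]
  have h3 : lam * ‖v‖ ^ 2 = lam * ∑ i, v i * v i := by
    rw [EuclideanSpace.norm_sq_eq]
    simp [sq]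
  rw [h2, h3]
  rw [Matrix.sub_mulVec, dotProduct_sub, Matrix.smul_mulVec, Matrix.one_mulVec,
    dotProduct_smul] at h1
  simp only [dotProduct, Matrix.mulVec, secondMoment, Matrix.of_apply, Pi.star_apply,
    star_trivial, smul_eq_mul, Finset.mul_sum] at h1
  have h4 : ∀ i j, v i * ((∫ x, x i * x j ∂D) * v j) = v i * (v j * ∫ x, x i * x j ∂D) :=
    fun i j => by ring
  simp only [h4, ← Finset.mul_sum] at h1 ⊢
  linarith

/-- The expected score in direction `w - w⋆` is at least `γ² λ ‖w - w⋆‖²`. -/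
theorem le_integral_score {d : ℕ} {Ω : Type*} [MeasurableSpace Ω] {P : Measure Ω}
    [IsProbabilityMeasure P] {X : Ω → EuclideanSpace ℝ (Fin d)} {ε : Ω → ℝ}
    (hX : Measurable X) (hε : Measurable ε) (hXε : IndepFun X ε P)
    {σ : ℝ → ℝ} (hσ : Differentiable ℝ σ)
    (hσ' : Continuous (deriv σ)) (hd : ∀ t, |deriv σ t| ≤ 1) {B R lam γ : ℝ}
    (hXB : ∀ᵐ ω ∂P, ‖X ω‖ ≤ B)
    (hlam : (secondMoment (P.map X) - lam • (1 : Matrix (Fin d) (Fin d) ℝ)).PosSemidef)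
    (hγ : 0 < γ) (hγσ : ∀ t ∈ Set.Icc (-(B * R)) (B * R), γ ≤ deriv σ t)
    (hε0 : ∫ ω, ε ω ∂P = 0) (hε1 : ∀ᵐ ω ∂P, |ε ω| ≤ 1) (hσ01 : ∀ t, σ t ∈ Set.Icc (0 : ℝ) 1)
    {w wstar : EuclideanSpace ℝ (Fin d)} (hw : ‖w‖ ≤ R) (hws : ‖wstar‖ ≤ R) :
    γ ^ 2 * lam * ‖w - wstar‖ ^ 2 ≤
      ∫ ω, score σ (σ (inner ℝ wstar (X ω)) + ε ω) w (X ω) (w - wstar) ∂P := by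
  have hσc := hσ.continuous
  have := Measure.isProbabilityMeasure_map (μ := P) hX.aemeasurable
  let F : EuclideanSpace ℝ (Fin d) → ℝ := fun x => score σ (σ (inner ℝ wstar x)) w x (w - wstar)
  let G : EuclideanSpace ℝ (Fin d) → ℝ := fun x => deriv σ (inner ℝ w x) * inner ℝ (w - wstar) x
  have hFm : Measurable F := by
    unfold F score
    exact Continuous.measurable (by fun_prop)
  have hGm : Measurable G := Continuous.measurable (by fun_prop)
  have hGb : ∀ x, ‖x‖ ≤ B → |G x| ≤ ‖w - wstar‖ * B := by
    intro x hx
    have hu : |inner ℝ (w - wstar) x| ≤ ‖w - wstar‖ * B :=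
      (abs_real_inner_le_norm _ _).trans (by gcongr)
    rw [abs_mul]
    calc _ ≤ 1 * (‖w - wstar‖ * B) := by
          gcongr
          exact hd _
      _ = _ := one_mul _
  have hFi : Integrable (fun ω => F (X ω)) P := by
    refine Integrable.of_bound (hFm.comp hX).aestronglyMeasurable (2 * B * ‖w - wstar‖) ?_
    filter_upwards [hXB] with ω h
    simpa using abs_score_le hd (fun t => abs_sub_label_le (e := 0) hσ01 (by simp) t _) h w _
  have hGi : Integrable (fun ω => ε ω * G (X ω)) P := by
    refine Integrable.of_bound (by fun_prop) (1 * (‖w - wstar‖ * B)) ?_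
    filter_upwards [hXB, hε1] with ω h h'
    rw [norm_mul]
    gcongr
    · exact h'
    · exact hGb _ h
  -- The noise enters the score linearly, multiplied by a function of `X` alone, so independence
  -- factors the mean.
  have hG0 : ∫ ω, ε ω * G (X ω) ∂P = 0 := by
    have hi : IndepFun ε (G ∘ X) P := (hXε.comp hGm measurable_id).symm
    have := hi.integral_fun_mul_eq_mul_integral hε.aestronglyMeasurable
      (hGm.comp hX).aestronglyMeasurable
    simpa [hε0] using this
  have hsplit : ∀ ω, score σ (σ (inner ℝ wstar (X ω)) + ε ω) w (X ω) (w - wstar) =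
      F (X ω) - ε ω * G (X ω) := fun ω => by
    simp only [F, G, score]; ring
  simp_rw [hsplit]
  rw [integral_sub hFi hGi, hG0, sub_zero]
  have hmapB : ∀ᵐ x ∂(P.map X), ‖x‖ ≤ B :=
    (ae_map_iff hX.aemeasurable (measurableSet_le (by fun_prop) (by fun_prop))).2 hXB
  have h1 := le_integral_inner_sq hmapB hlam (w - wstar)
  rw [integral_map hX.aemeasurable (by fun_prop)] at h1
  calc γ ^ 2 * lam * ‖w - wstar‖ ^ 2 = γ ^ 2 * (lam * ‖w - wstar‖ ^ 2) := by ring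
    _ ≤ γ ^ 2 * ∫ ω, inner ℝ (w - wstar) (X ω) ^ 2 ∂P := by gcongr
    _ = ∫ ω, γ ^ 2 * inner ℝ (w - wstar) (X ω) ^ 2 ∂P := (integral_const_mul _ _).symm
    _ ≤ _ := by
      refine integral_mono_of_nonneg (ae_of_all _ fun ω => by positivity) hFi ?_
      filter_upwards [hXB] with ω h
      have hb : ∀ z : EuclideanSpace ℝ (Fin d), ‖z‖ ≤ R → |inner ℝ z (X ω)| ≤ B * R := by
        intro z hz
        refine (abs_real_inner_le_norm _ _).trans ?_
        rw [mul_comm]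
        have := norm_nonneg (X ω)
        gcongr
        linarith
      exact sq_mul_inner_sq_le_score hσ hγ hγσ (hb w hw) (hb wstar hws)

end GLM

/-! ### Constants, tail bound at a fixed parameter, transfer to critical points -/

namespace GLM

/-- Numerical conversion of the net bound into the final rate. -/
theorem rate_bound {d n : ℕ} (hd : 1 ≤ d) (hn : 1 ≤ n) {B R lam γ δ a v : ℝ} (hB : 0 < B)
    (hBR : 1 ≤ B * R) (hlam : 0 < lam) (hlamB : lam ≤ B ^ 2) (hγ : 0 < γ) (hγ1 : γ ≤ 1)
    (hδ : 0 < δ) (hδ1 : δ < 1)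
    (hv : γ ^ 2 * lam * v * n ≤ 3 * B + 2 * B *
      √(2 * n * (d * Real.log (3 * (n * B * R)) + Real.log (1 / δ))))
    (ha : a ≤ v + 1 / (n * B)) :
    a ≤ 7 * B / (γ ^ 2 * lam) *
      √((d * (2 + Real.log (n * B * R)) + Real.log (1 / δ)) / n) := by
  have hn1 : (1 : ℝ) ≤ n := by exact_mod_cast hn
  have hd1 : (1 : ℝ) ≤ d := by exact_mod_cast hd
  have hm : 1 ≤ n * B * R := by nlinarith
  have hlogm : 0 ≤ Real.log (n * B * R) := Real.log_nonneg hm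
  have hlogδ : 0 ≤ Real.log (1 / δ) := Real.log_nonneg (by rw [le_div_iff₀ hδ]; linarith)
  have hlog3 : Real.log 3 ≤ 2 := by
    have := Real.log_le_sub_one_of_pos (show (0 : ℝ) < 3 by norm_num)
    linarith
  set Γ := d * (2 + Real.log (n * B * R)) + Real.log (1 / δ) with hΓ
  -- This uses `1 ≤ d`, and yields `1 ≤ n * S`, which absorbs the additive terms below.
  have hΓ1 : 1 ≤ Γ := by nlinarith
  have hLΓ : d * Real.log (3 * (n * B * R)) + Real.log (1 / δ) ≤ Γ := by
    rw [Real.log_mul (by norm_num) (by positivity)]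
    have : (d : ℝ) * (Real.log 3 + Real.log (n * B * R)) ≤ d * (2 + Real.log (n * B * R)) := by
      gcongr
    linarith
  set S := √(Γ / n) with hS
  have hS2 : S ^ 2 = Γ / n := Real.sq_sqrt (by positivity)
  have hnS2 : n * S ^ 2 = Γ := by rw [hS2]; field_simp
  have hS0 : 0 ≤ S := Real.sqrt_nonneg _
  have h1 : √(2 * n * (d * Real.log (3 * (n * B * R)) + Real.log (1 / δ))) ≤ 3 / 2 * (n * S) := by
    apply Real.sqrt_le_iff.2 ⟨by positivity, ?_⟩
    calc _ ≤ 2 * n * Γ := by gcongr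
      _ ≤ (3 / 2 * (n * S)) ^ 2 := by rw [← hnS2]; nlinarith [sq_nonneg (n * S)]
  have h2 : 1 ≤ n * S := by
    have : 1 ≤ (n * S) ^ 2 := by nlinarith
    exact (one_le_sq_iff₀ (by positivity)).1 this
  -- The total constant is `7`: here `3 + 2 * (3 / 2) = 6`, and the net radius adds `1` in `h4`.
  have h3 : γ ^ 2 * lam * v * n ≤ 6 * B * (n * S) := by
    nlinarith [mul_le_mul_of_nonneg_left h1 (show 0 ≤ 2 * B by positivity),
      mul_le_mul_of_nonneg_left h2 (show 0 ≤ 3 * B by positivity)]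
  have h4 : γ ^ 2 * lam * (1 / (n * B)) * n ≤ B * (n * S) := by
    have : γ ^ 2 * lam ≤ 1 * B ^ 2 := by
      gcongr
      exact pow_le_one₀ hγ.le hγ1
    calc γ ^ 2 * lam * (1 / (n * B)) * n = (γ ^ 2 * lam) / B := by field_simp
      _ ≤ (1 * B ^ 2) / B := by gcongr
      _ = B * 1 := by field_simp
      _ ≤ _ := by gcongr
  have h5 : γ ^ 2 * lam * a * n ≤ γ ^ 2 * lam * (v + 1 / (n * B)) * n := by gcongr
  rw [div_mul_eq_mul_div, le_div_iff₀ (by positivity)]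
  have hn0 : (0 : ℝ) < n := by linarith
  refine le_of_mul_le_mul_right ?_ hn0
  linarith

theorem measurable_score_comp {d : ℕ} {Ω : Type*} [MeasurableSpace Ω] {σ : ℝ → ℝ}
    (hσ : Continuous σ) (hσ' : Continuous (deriv σ)) {X : Ω → EuclideanSpace ℝ (Fin d)}
    {ε : Ω → ℝ} (hX : Measurable X) (hε : Measurable ε) (wstar w u : EuclideanSpace ℝ (Fin d)) :
    Measurable fun ω => score σ (σ (inner ℝ wstar (X ω)) + ε ω) w (X ω) u := by
  have := (measurable_score hσ hσ' wstar w u).comp (hX.prodMk hε)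
  exact this

/-- High-probability lower bound for the empirical score at a fixed parameter. -/
theorem measureReal_sum_score_lt_le {d n : ℕ} (hn : 1 ≤ n) {B R lam γ L : ℝ}
    {σ : ℝ → ℝ} {wstar w : EuclideanSpace ℝ (Fin d)} {Dx : Measure (EuclideanSpace ℝ (Fin d))}
    {Ω : Type*} [MeasurableSpace Ω] {P : Measure Ω} [IsProbabilityMeasure P]
    {X : Fin n → Ω → EuclideanSpace ℝ (Fin d)} {ε : Fin n → Ω → ℝ}
    (hX : ∀ i, Measurable (X i)) (hε : ∀ i, Measurable (ε i))
    (hind : iIndepFun (fun i ω => (X i ω, ε i ω)) P) (hXε : ∀ i, IndepFun (X i) (ε i) P)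
    (hmap : ∀ i, P.map (X i) = Dx) (hXB : ∀ i, ∀ᵐ ω ∂P, ‖X i ω‖ ≤ B)
    (hlam : (secondMoment Dx - lam • (1 : Matrix (Fin d) (Fin d) ℝ)).PosSemidef)
    (hB : 0 < B) (hws : ‖wstar‖ ≤ R) (hw : ‖w‖ ≤ R) (hne : w ≠ wstar)
    (hσ : Differentiable ℝ σ) (hσ' : Continuous (deriv σ))
    (hσ01 : ∀ t, σ t ∈ Set.Icc (0 : ℝ) 1) (hd : ∀ t, |deriv σ t| ≤ 1)
    (hγ : 0 < γ) (hγσ : ∀ t ∈ Set.Icc (-(B * R)) (B * R), γ ≤ deriv σ t)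
    (hε0 : ∀ i, ∫ ω, ε i ω ∂P = 0) (hε1 : ∀ i, ∀ᵐ ω ∂P, |ε i ω| ≤ 1) (hL : 0 ≤ L) :
    P.real {ω | ∑ i, score σ (σ (inner ℝ wstar (X i ω)) + ε i ω) w (X i ω) (w - wstar) <
      n * (γ ^ 2 * lam * ‖w - wstar‖ ^ 2) - 2 * B * ‖w - wstar‖ * √(2 * n * L)} ≤
      Real.exp (-L) := by
  have hv : 0 < ‖w - wstar‖ := norm_pos_iff.2 (sub_ne_zero.2 hne)
  have hm := measurable_score hσ.continuous hσ' wstar w (w - wstar)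
  let Z : Fin n → Ω → ℝ := fun i ω =>
    score σ (σ (inner ℝ wstar (X i ω)) + ε i ω) w (X i ω) (w - wstar)
  have hZm : ∀ i, Measurable (Z i) := fun i =>
    measurable_score_comp hσ.continuous hσ' (hX i) (hε i) wstar w (w - wstar)
  have hZ : iIndepFun Z P := hind.comp
    (fun _ p => score σ (σ (inner ℝ wstar p.1) + p.2) w p.1 (w - wstar)) fun _ => hm
  have hZb : ∀ i, ∀ᵐ ω ∂P, |Z i ω| ≤ 2 * B * ‖w - wstar‖ := by
    intro i
    filter_upwards [hXB i, hε1 i] with ω h h'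
    exact abs_score_le hd (fun t => abs_sub_label_le hσ01 h' t _) h _ _
  have hZi : ∀ i, γ ^ 2 * lam * ‖w - wstar‖ ^ 2 ≤ ∫ ω, Z i ω ∂P := by
    intro i
    refine le_integral_score (hX i) (hε i) (hXε i) hσ hσ' hd (hXB i) ?_ hγ hγσ (hε0 i) (hε1 i)
      hσ01 hw hws
    rwa [hmap i]
  exact hoeffding_lower_tail hn hZ hZm (by positivity) hL hZb hZi

/-- Deterministic step: a critical point close to `w'`, at which the empirical score obeys the
lower bound of `measureReal_sum_score_lt_le`, forces `w'` to be close to `w⋆`. -/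
theorem norm_sub_le_of_sum_score {d n : ℕ} {B lam γ r T : ℝ} (hB : 0 < B)
    {σ : ℝ → ℝ} {wstar w w' : EuclideanSpace ℝ (Fin d)} {x : Fin n → EuclideanSpace ℝ (Fin d)}
    {y : Fin n → ℝ} (hx : ∀ i, ‖x i‖ ≤ B) (hy : ∀ i t, |σ t - y i| ≤ 2)
    (hσ : Differentiable ℝ σ) (hσ' : Differentiable ℝ (deriv σ))
    (hd : ∀ t, |deriv σ t| ≤ 1) (hdd : ∀ t, |deriv (deriv σ) t| ≤ 1)
    (hww' : ‖w - w'‖ ≤ r) (hne : w' ≠ wstar)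
    (hw : ∑ i, score σ (y i) w (x i) (w' - wstar) = 0)
    (hw' : n * (γ ^ 2 * lam * ‖w' - wstar‖ ^ 2) - 2 * B * ‖w' - wstar‖ * T ≤
      ∑ i, score σ (y i) w' (x i) (w' - wstar)) :
    γ ^ 2 * lam * ‖w' - wstar‖ * n ≤ n * (3 * B ^ 2 * r) + 2 * B * T := by
  have hv : 0 < ‖w' - wstar‖ := norm_pos_iff.2 (sub_ne_zero.2 hne)
  have h1 : ∑ i, score σ (y i) w' (x i) (w' - wstar) ≤
      n * (3 * B ^ 2 * r * ‖w' - wstar‖) := by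
    rw [← sub_zero (∑ i, score σ (y i) w' (x i) (w' - wstar)), ← hw, ← Finset.sum_sub_distrib]
    have : ∀ i ∈ Finset.univ, score σ (y i) w' (x i) (w' - wstar) -
        score σ (y i) w (x i) (w' - wstar) ≤ 3 * B ^ 2 * r * ‖w' - wstar‖ := by
      intro i _
      refine (le_abs_self _).trans
        ((abs_score_sub_le hσ hσ' hd hdd (hy i) (hx i) w' w _).trans ?_)
      rw [norm_sub_rev w' w]
      gcongr
    simpa using Finset.sum_le_card_nsmul Finset.univ _ _ this
  refine le_of_mul_le_mul_right ?_ hv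
  linarith

/-- Testing the moment bound on a unit vector. With `γ ≤ 1` it lets the net radius `1 / (n * B)` be
absorbed into the rate. -/
theorem le_sq_of_secondMoment {d : ℕ} (hd : 1 ≤ d) {D : Measure (EuclideanSpace ℝ (Fin d))}
    [IsProbabilityMeasure D] {B lam : ℝ} (hB : ∀ᵐ x ∂D, ‖x‖ ≤ B)
    (h : (secondMoment D - lam • (1 : Matrix (Fin d) (Fin d) ℝ)).PosSemidef) : lam ≤ B ^ 2 := by
  let v : EuclideanSpace ℝ (Fin d) := EuclideanSpace.single ⟨0, hd⟩ 1
  have hv : ‖v‖ = 1 := by simp [v]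
  have h1 := le_integral_inner_sq hB h v
  rw [hv, one_pow, mul_one] at h1
  refine h1.trans ?_
  have : ∫ x, inner ℝ v x ^ 2 ∂D ≤ ∫ _, B ^ 2 ∂D := by
    refine integral_mono_of_nonneg (ae_of_all _ fun x => by positivity) (integrable_const _) ?_
    filter_upwards [hB] with x hx
    have h2 := abs_real_inner_le_norm v x
    rw [hv, one_mul] at h2
    exact sq_le_sq' (by linarith [(abs_le.1 h2).1]) ((abs_le.1 h2).2.trans hx)
  simpa using this

end GLM

/-! ### Union bound over the net and conclusion -/

theorem mainTheorem4 :
    ∃ C₁ C₂ : ℝ, 0 < C₁ ∧ 0 < C₂ ∧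
      ∀ (d n : ℕ) (_ : 1 ≤ n) (B R lam γ δ : ℝ)
        (σ : ℝ → ℝ) (wstar : EuclideanSpace ℝ (Fin d))
        (Dx : Measure (EuclideanSpace ℝ (Fin d))) (_ : IsProbabilityMeasure Dx)
        (Ω : Type*) (_ : MeasurableSpace Ω) (P : Measure Ω) (_ : IsProbabilityMeasure P)
        (X : Fin n → Ω → EuclideanSpace ℝ (Fin d)) (ε : Fin n → Ω → ℝ),
        -- the confidence level
        0 < δ → δ < 1 →
        -- the sample: i.i.d. pairs of an input with law `Dx` and a noise independent of it
        (∀ i, Measurable (X i)) → (∀ i, Measurable (ε i)) →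
        iIndepFun (fun i ω => (X i ω, ε i ω)) P →
        (∀ i, IndepFun (X i) (ε i) P) →
        (∀ i, P.map (X i) = Dx) →
        (∀ i j, IdentDistrib (ε i) (ε j) P P) →
        -- the inputs are bounded and non-degenerate
        (∀ᵐ x ∂Dx, ‖x‖ ≤ B) →
        0 < lam →
        (GLM.secondMoment Dx - lam • (1 : Matrix (Fin d) (Fin d) ℝ)).PosSemidef →
        -- the ground truth
        ‖wstar‖ ≤ R → 1 ≤ B * R →
        -- the activation
        StrictMono σ → Differentiable ℝ σ → Differentiable ℝ (deriv σ) →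
        (∀ t, σ t ∈ Set.Icc (0 : ℝ) 1) →
        (∀ t, |deriv σ t| ≤ 1) → (∀ t, |deriv (deriv σ) t| ≤ 1) →
        0 < γ → (∀ t ∈ Set.Icc (-(B * R)) (B * R), γ ≤ deriv σ t) →
        -- the noise is centered and bounded
        (∀ i, ∫ ω, ε i ω ∂P = 0) → (∀ i, ∀ᵐ ω ∂P, |ε i ω| ≤ 1) →
        ∃ E : Set Ω, MeasurableSet E ∧ 1 - δ ≤ P.real E ∧
          ∀ ω ∈ E, ∀ w : EuclideanSpace ℝ (Fin d), ‖w‖ ≤ R →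
            (gradient (GLM.empiricalRisk σ (fun i => X i ω)
                (GLM.labels σ wstar (fun i => X i ω) (fun i => ε i ω))) w = 0 ∨
              IsLocalMin (GLM.empiricalRisk σ (fun i => X i ω)
                (GLM.labels σ wstar (fun i => X i ω) (fun i => ε i ω))) w) →
            ‖w - wstar‖ ≤ C₁ * B / (γ ^ 2 * lam) *
              √((d * (C₂ + Real.log (n * B * R)) + Real.log (1 / δ)) / n) := by
  refine ⟨7, 2, by norm_num, by norm_num, ?_⟩
  intro d n hn B R lam γ δ σ wstar Dx _ Ω _ P _ X ε hδ hδ1 hX hε hind hXε hmap _ hDB hlam hpsd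
    hws hBR _ hσ hσ' hσ01 hd hdd hγ hγσ hε0 hε1
  -- In dimension zero there is no unit vector to give `lam ≤ B ^ 2`, but `w = wstar` is forced.
  rcases Nat.eq_zero_or_pos d with rfl | hd1
  · refine ⟨Set.univ, MeasurableSet.univ, by simpa using hδ.le, fun ω _ w _ _ => ?_⟩
    have hR : 0 ≤ R := (norm_nonneg _).trans hws
    have hB : 0 ≤ B := by
      by_contra! hB
      nlinarith
    rw [Subsingleton.elim w wstar, sub_self, norm_zero]
    positivity
  have hR : 0 < R := by
    refine lt_of_le_of_ne ((norm_nonneg _).trans hws) fun h => ?_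
    rw [← h, mul_zero] at hBR
    linarith
  have hB : 0 < B := by
    by_contra! hB
    nlinarith
  have hn0 : (0 : ℝ) < n := by exact_mod_cast hn
  have hn1 : (1 : ℝ) ≤ n := by exact_mod_cast hn
  have hXB : ∀ i, ∀ᵐ ω ∂P, ‖X i ω‖ ≤ B := fun i =>
    ae_of_ae_map (hX i).aemeasurable (by rw [hmap i]; exact hDB)
  have hγ1 : γ ≤ 1 := (hγσ 0 ⟨by linarith, by linarith⟩).trans ((le_abs_self _).trans (hd 0))
  have hlamB : lam ≤ B ^ 2 := GLM.le_sq_of_secondMoment hd1 hDB hpsd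
  have hm : 1 ≤ n * B * R := by nlinarith
  -- Chosen so that `exp (-L)` is `δ` divided by the bound `(3 * n * B * R) ^ d` on the size of the
  -- net.
  set L := d * Real.log (3 * (n * B * R)) + Real.log (1 / δ) with hLdef
  have hL : 0 ≤ L := by
    have h1 : 0 ≤ Real.log (3 * (n * B * R)) := Real.log_nonneg (by linarith)
    have h2 : 0 ≤ Real.log (1 / δ) := Real.log_nonneg (by rw [le_div_iff₀ hδ]; linarith)
    positivity
  obtain ⟨N, hNR, hNcov, hNcard⟩ := exists_finset_net_closedBall (EuclideanSpace ℝ (Fin d))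
    (r := 1 / (n * B)) (R := R) (by positivity)
    (by rw [div_le_iff₀ (by positivity)]; linarith)
  have hcard : (N.card : ℝ) * Real.exp (-L) ≤ δ := by
    have e1 : 3 * R / (1 / (n * B)) = 3 * (n * B * R) := by field_simp
    rw [e1, finrank_euclideanSpace_fin] at hNcard
    have e2 : Real.exp (-L) = δ / (3 * (n * B * R)) ^ d := by
      rw [hLdef, neg_add, Real.exp_add, Real.exp_neg, Real.exp_nat_mul,
        Real.exp_log (by positivity), Real.log_div one_ne_zero hδ.ne', Real.log_one, zero_sub,
        neg_neg, Real.exp_log hδ]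
      ring
    rw [e2, mul_div_assoc', div_le_iff₀ (by positivity), mul_comm δ]
    gcongr
  let bad : EuclideanSpace ℝ (Fin d) → Set Ω := fun w =>
    {ω | ∑ i, GLM.score σ (σ (inner ℝ wstar (X i ω)) + ε i ω) w (X i ω) (w - wstar) <
      n * (γ ^ 2 * lam * ‖w - wstar‖ ^ 2) - 2 * B * ‖w - wstar‖ * √(2 * n * L)}
  have hbadm : ∀ w, MeasurableSet (bad w) := fun w =>
    measurableSet_lt (Finset.measurable_fun_sum _ fun i _ =>
      GLM.measurable_score_comp hσ.continuous hσ'.continuous (hX i) (hε i) wstar w (w - wstar)) measurable_const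
  classical
  let Bad : Set Ω := ⋃ w ∈ N.filter (· ≠ wstar), bad w
  have hBadm : MeasurableSet Bad := Finset.measurableSet_biUnion _ fun w _ => hbadm w
  have hBad : P.real Bad ≤ δ := by
    refine (measureReal_biUnion_finset_le _ _).trans ?_
    calc ∑ w ∈ N.filter (· ≠ wstar), P.real (bad w)
        ≤ ∑ _w ∈ N.filter (· ≠ wstar), Real.exp (-L) := by
          refine Finset.sum_le_sum fun w hw => ?_
          rw [Finset.mem_filter] at hw
          exact GLM.measureReal_sum_score_lt_le hn hX hε hind hXε hmap hXB hpsd hB hws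
            (hNR w hw.1) hw.2 hσ hσ'.continuous hσ01 hd hγ hγσ hε0 hε1 hL
      _ = (N.filter (· ≠ wstar)).card * Real.exp (-L) := by simp
      _ ≤ N.card * Real.exp (-L) := by
          gcongr
          exact Finset.filter_subset _ _
      _ ≤ δ := hcard
  -- The Lipschitz step is pointwise in `ω`, so the almost sure bounds are built into the event.
  let A : Set Ω := {ω | ∀ i, ‖X i ω‖ ≤ B ∧ |ε i ω| ≤ 1}
  have hAm : MeasurableSet A := by
    have : A = ⋂ i, {ω | ‖X i ω‖ ≤ B} ∩ {ω | |ε i ω| ≤ 1} := by ext; simp [A]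
    rw [this]
    exact MeasurableSet.iInter fun i =>
      (measurableSet_le (hX i).norm measurable_const).inter
        (measurableSet_le (hε i).abs measurable_const)
  have hA : ∀ᵐ ω ∂P, ω ∈ A := ae_all_iff.2 fun i => (hXB i).and (hε1 i)
  refine ⟨A ∩ Badᶜ, hAm.inter hBadm.compl, ?_, ?_⟩
  · have : P.real (A ∩ Badᶜ) = P.real Badᶜ := by
      refine measureReal_congr ?_
      filter_upwards [hA] with ω hω
      exact propext ⟨fun h => h.2, fun h => ⟨hω, h⟩⟩
    rw [this, probReal_compl_eq_one_sub hBadm]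
    linarith
  · rintro ω ⟨hωA, hωB⟩ w hwR hcrit
    obtain ⟨w', hw'N, hww'⟩ := hNcov w hwR
    refine GLM.rate_bound (v := ‖w' - wstar‖) hd1 hn hB hBR hlam hlamB hγ hγ1 hδ hδ1 ?_ ?_
    · rcases eq_or_ne w' wstar with h | hne
      · rw [h, sub_self, norm_zero, mul_zero, zero_mul]
        positivity
      · have hnb : ω ∉ bad w' := fun h => hωB <| Set.mem_biUnion
          (Finset.mem_coe.2 (Finset.mem_filter.2 ⟨hw'N, hne⟩)) h
        have h1 := GLM.norm_sub_le_of_sum_score hB (fun i => (hωA i).1)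
          (fun i t => GLM.abs_sub_label_le hσ01 (hωA i).2 t _) hσ hσ' hd hdd hww' hne
          (GLM.sum_score_eq_zero hn hσ hcrit _) (not_lt.1 hnb)
        have h2 : n * (3 * B ^ 2 * (1 / (n * B))) = 3 * B := by field_simp
        rwa [h2] at h1
    · calc ‖w - wstar‖ = ‖(w' - wstar) + (w - w')‖ := by congr 1; abel
        _ ≤ _ := (norm_add_le _ _).trans (by gcongr)
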